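/- **Setting.** For a non-empty set $X$, let $\mathbb{R}^X_b$ be the space of bounded functions $X\to\mathbb{R}$ with the uniform norm $\|\cdot\|_\infty$. For $\Phi\subseteq\mathbb{R}^X_b$ put $D_\Phi(\varphi_1,\varphi_2)=\|\varphi_1-\varphi_2\|_\infty$ on $\Phi$ and $D_X(x_1,x_2)=\sup_{\varphi\in\Phi}|\varphi(x_1)-\varphi(x_2)|$ on $X$; we say that $\Phi$ endows $X$ with a metric structure if $D_X$ is a (finite) metric. Let $\mathrm{Aut}_\Phi(X)$ be the group of bijections $g$ of $X$ with $\varphi\circ g,\ \varphi\circ g^{-1}\in\Phi$ for all $\varphi\in\Phi$. A *perception pair* $(\Phi,G)$ with $\mathrm{dom}(\Phi)=X$ consists of such a $\Phi$ and a subgroup $G\le\mathrm{Aut}_\Phi(X)$; $G$ carries the (extended) pseudo-distance $D_{\mathrm{Aut}}(g,h)=\sup_{\varphi\in\Phi}\|\varphi\circ g-\varphi\circ h\|_\infty$. The pair is *compact* if $\Phi$, $G$ and $X$ are compact. A *compactification* of $(\Phi,G)$, $\mathrm{dom}(\Phi)=X$, is a compact perception pair $(\Phi^*,G^*)$, $\mathrm{dom}(\Phi^*)=X^*$,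 for which $D_{X^*}$ is a metric, together with isometric embeddings $j:X\to X^*$, $i:\Phi\to\Phi^*$, $k:G\to G^*$ with dense images such that $i(\varphi)\circ j=\varphi$ for all $\varphi\in\Phi$ and $k(g)\circ j=j\circ g$ for all $g\in G$. Given perception pairs $(\Phi,G)$, $(\Psi,H)$ and a group homomorphism $T:G\to H$, a *GENEO* $(F,T):(\Phi,G)\to(\Psi,H)$ is a map $F:\Phi\to\Psi$ with $F(\varphi\circ g)=F(\varphi)\circ T(g)$ for all $\varphi\in\Phi$, $g\in G$ and $\|F(\varphi_1)-F(\varphi_2)\|_\infty\le\|\varphi_1-\varphi_2\|_\infty$ for all $\varphi_1,\varphi_2\in\Phi$. The set $\mathcal{F}^{\mathrm{all}}_T$ of all of them carries the distance $D_{\mathrm{GENEO}}(F_1,F_2)=\sup_{\varphi\in\Phi}\|F_1(\varphi)-F_2(\varphi)\|_\infty$. A subset $\mathcal{F}\subseteq\mathcal{F}^{\mathrm{all}}_T$ is *collectionwise surjective* if $\bigcup_{F\in\mathcal{F}}F(\Phi)=\Psi$. **Theorem.** Let $(\Phi,G)$ and $(\Psi,H)$ be perception pairs with $\mathrm{dom}(\Phi)=X$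 and $\mathrm{dom}(\Psi)=Y$, let $T:G\to H$ be a group homomorphism, and let $\mathcal{F}\subseteq\mathcal{F}^{\mathrm{all}}_T$ be collectionwise surjective. Assume that $\Phi$ and $\Psi$ are totally bounded and endow $X$ and $Y$ with metric structures. Then $\mathcal{F}$ admits a compactification: there are compactifications $(\Phi^*,G^*)$ of $(\Phi,G)$, with embeddings $j_1,i_1,k_1$, and $(\Psi^*,H^*)$ of $(\Psi,H)$, with embeddings $j_2,i_2,k_2$, a group homomorphism $T^*:G^*\to H^*$, a compact subset $\mathcal{F}^*\subseteq\mathcal{F}^{\mathrm{all}}_{T^*}$ of GENEOs $(\Phi^*,G^*)\to(\Psi^*,H^*)$, and an isometric embedding $f:\mathcal{F}\to\mathcal{F}^*$ with dense image, such that $$i_2\circ F=f(F)\circ i_1\quad\text{for every }F\in\mathcal{F},\qquad k_2\circ T=T^*\circ k_1 .$$ -/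

import Mathlib

open scoped ENNReal

universe u v u' v'

/-- The normed space of bounded real-valued functions on `X`, with the uniform norm. -/
abbrev BddFun (X : Type u) : Type u := lp (fun _ : X => ℝ) ∞

theorem BddFun.memℓp_comp {X : Type u} (φ : BddFun X) (g : X → X) :
    Memℓp (fun x => φ (g x)) ∞ := by
  rw [memℓp_infty_iff]
  refine (memℓp_infty_iff.1 (lp.memℓp φ)).mono ?_
  rintro _ ⟨x, rfl⟩
  exact ⟨g x, rfl⟩

/-- The composite `φ ∘ g` of a bounded function with a self-map of its domain. -/
def BddFun.comp {X : Type u} (φ : BddFun X) (g : X → X) : BddFun X :=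
  ⟨fun x => φ (g x), φ.memℓp_comp g⟩

theorem BddFun.comp_apply {X : Type u} (φ : BddFun X) (g : X → X) (x : X) :
    φ.comp g x = φ (g x) := rfl

/-- The group `Aut_Φ(X)` of invertible `Φ`-operations: the bijections `g` of `X` such that
`φ ∘ g` and `φ ∘ g⁻¹` belong to `Φ` for all `φ ∈ Φ`. -/
def AutGroup {X : Type u} (Φ : Set (BddFun X)) : Subgroup (Equiv.Perm X) where
  carrier := {g | ∀ φ ∈ Φ, φ.comp g ∈ Φ ∧ φ.comp g.symm ∈ Φ}
  one_mem' := fun _ hφ => ⟨hφ, hφ⟩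
  mul_mem' := fun {g h} hg hh φ hφ =>
    ⟨(hh (φ.comp g) (hg φ hφ).1).1, (hg (φ.comp h.symm) (hh φ hφ).2).2⟩
  inv_mem' := fun {_} hg φ hφ => ⟨(hg φ hφ).2, (hg φ hφ).1⟩

/-- A perception pair `(Φ, G)` with `dom(Φ) = X`: a set `Φ` of bounded real-valued functions on `X`
and a subgroup `G` of `Aut_Φ(X)`. The type `P.Φ` of signals carries the uniform distance
inherited from `BddFun X`. -/
structure PerceptionPair (X : Type u) where
  Φ : Set (BddFun X)
  G : Subgroup (Equiv.Perm X)
  G_le : G ≤ AutGroup Φ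

namespace PerceptionPair

variable {X : Type u} {X' : Type u'}

/-- The common domain `X` of the signals, to be equipped with the pseudo-distance `D_X`. -/
def Dom (_P : PerceptionPair X) : Type u := X

/-- The group `G`, to be equipped with the pseudo-distance `D_Aut`. -/
def Grp (P : PerceptionPair X) : Type u := P.G

instance (P : PerceptionPair X) : Group P.Grp := inferInstanceAs (Group P.G)

/-- The value of a signal at a point of the domain. -/
def eval (P : PerceptionPair X) (φ : P.Φ) (x : P.Dom) : ℝ := (φ : BddFun X) x

/-- The bijection of the domain given by an element of the group. -/
def perm (P : PerceptionPair X) (g : P.Grp) : Equiv.Perm P.Dom := g.1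

/-- The right action `(φ, g) ↦ φ ∘ g` of `G` on `Φ`. -/
def act (P : PerceptionPair X) (φ : P.Φ) (g : P.Grp) : P.Φ :=
  ⟨(φ : BddFun X).comp (P.perm g), (P.G_le g.2 φ φ.2).1⟩

/-- The extended pseudo-distance `D_X(x, y) = sup_{φ ∈ Φ} |φ x - φ y|`. -/
noncomputable instance (P : PerceptionPair X) : PseudoEMetricSpace P.Dom where
  edist x y := ⨆ φ : P.Φ, edist (P.eval φ x) (P.eval φ y)
  edist_self x := by simp
  edist_comm x y := by simp only [edist_comm]
  edist_triangle x y z := iSup_le fun φ =>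
    (edist_triangle _ (P.eval φ y) _).trans
      (add_le_add (le_iSup (fun φ : P.Φ => edist (P.eval φ x) (P.eval φ y)) φ)
        (le_iSup (fun φ : P.Φ => edist (P.eval φ y) (P.eval φ z)) φ))

/-- The extended pseudo-distance `D_Aut(g, h) = sup_{φ ∈ Φ} ‖φ ∘ g - φ ∘ h‖_∞`. -/
noncomputable instance (P : PerceptionPair X) : PseudoEMetricSpace P.Grp where
  edist g h := ⨆ φ : P.Φ, edist (P.act φ g) (P.act φ h)
  edist_self x := by simp
  edist_comm x y := by simp only [edist_comm]
  edist_triangle a b c := iSup_le fun φ =>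
    (edist_triangle _ (P.act φ b) _).trans
      (add_le_add (le_iSup (fun φ : P.Φ => edist (P.act φ a) (P.act φ b)) φ)
        (le_iSup (fun φ : P.Φ => edist (P.act φ b) (P.act φ c)) φ))

/-- `Φ` endows `X` with a metric structure: the extended pseudo-distance `D_X` is a metric, that is,
it is finite and vanishes only on the diagonal. -/
def InducesMetric (P : PerceptionPair X) : Prop :=
  ∀ x y : P.Dom, edist x y ≠ ⊤ ∧ (edist x y = 0 → x = y)

/-- A perception pair is compact if `Φ`, `G` and `X` are all compact. -/
structure IsCompactPair (P : PerceptionPair X) : Prop where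
  compact_signals : CompactSpace P.Φ
  compact_group : CompactSpace P.Grp
  compact_dom : CompactSpace P.Dom

/-- An isometric embedding of the perception pair `P` into the perception pair `P'`: isometric
embeddings `j`, `i`, `k` of domains, signals and groups, with dense images, such that
`i(φ) ∘ j = φ` and `k(g) ∘ j = j ∘ g`. -/
structure IsometricEmbedding (P : PerceptionPair X) (P' : PerceptionPair X') where
  j : P.Dom → P'.Dom
  i : P.Φ → P'.Φ
  k : P.Grp → P'.Grp
  isometry_j : Isometry j
  isometry_i : Isometry i
  isometry_k : Isometry k
  injective_j : Function.Injective j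
  injective_k : Function.Injective k
  dense_j : DenseRange j
  dense_i : DenseRange i
  dense_k : DenseRange k
  eval_i : ∀ (φ : P.Φ) (x : P.Dom), P'.eval (i φ) (j x) = P.eval φ x
  perm_k : ∀ (g : P.Grp) (x : P.Dom), P'.perm (k g) (j x) = j (P.perm g x)

/-- The perception pair `P'`, together with the given embedding, is a compactification of `P`.
Compactifications are Hausdorff, so the domain of `P'` is required to be a compact metric space,
not merely a compact pseudo-metric one. -/
structure Compactification (P : PerceptionPair X) (P' : PerceptionPair X') extends
    IsometricEmbedding P P' where
  compact : P'.IsCompactPair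
  metric : P'.InducesMetric

end PerceptionPair

/-- A group equivariant non-expansive operator `(F, T) : (Φ, G) → (Ψ, H)` with respect to the
homomorphism `T : G → H`; the type `GENEO P Q T` is the space of all of them. -/
structure GENEO {X : Type u} {Y : Type v} (P : PerceptionPair X) (Q : PerceptionPair Y)
    (T : P.Grp →* Q.Grp) where
  toFun : P.Φ → Q.Φ
  equivariant : ∀ (φ : P.Φ) (g : P.Grp), toFun (P.act φ g) = Q.act (toFun φ) (T g)
  nonexpansive : ∀ φ₁ φ₂ : P.Φ, dist (toFun φ₁) (toFun φ₂) ≤ dist φ₁ φ₂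

namespace GENEO

variable {X : Type u} {Y : Type v} {P : PerceptionPair X} {Q : PerceptionPair Y}
  {T : P.Grp →* Q.Grp} {X' : Type u'} {Y' : Type v'} {P' : PerceptionPair X'}
  {Q' : PerceptionPair Y'} {T' : P'.Grp →* Q'.Grp}

/-- The distance `D_GENEO(F₁, F₂) = sup_{φ ∈ Φ} ‖F₁ φ - F₂ φ‖_∞` between operators. -/
noncomputable instance : EMetricSpace (GENEO P Q T) where
  edist F₁ F₂ := ⨆ φ : P.Φ, edist (F₁.toFun φ) (F₂.toFun φ)
  edist_self x := by simp
  edist_comm x y := by simp only [edist_comm]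
  edist_triangle a b c := iSup_le fun φ =>
    (edist_triangle _ (b.toFun φ) _).trans
      (add_le_add (le_iSup (fun φ : P.Φ => edist (a.toFun φ) (b.toFun φ)) φ)
        (le_iSup (fun φ : P.Φ => edist (b.toFun φ) (c.toFun φ)) φ))
  eq_of_edist_eq_zero := by
    rintro ⟨a, _, _⟩ ⟨b, _, _⟩ h
    have hab : a = b := funext fun φ => edist_eq_zero.1 (ENNReal.iSup_eq_zero.1 h φ)
    subst hab
    rfl

/-- A space `F` of GENEOs is collectionwise surjective if the images of its members cover `Ψ`. -/
def CollectionwiseSurjective (F : Set (GENEO P Q T)) : Prop :=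
  ∀ ψ : Q.Φ, ∃ A ∈ F, ∃ φ : P.Φ, A.toFun φ = ψ

/-- The space `F'` of GENEOs `(Φ*, G*) → (Ψ*, H*)` with respect to `T'` is a compactification of the
space `F` of GENEOs `(Φ, G) → (Ψ, H)` with respect to `T`: it is compact, there are
compactifications `c₁ = (j₁, i₁, k₁)` and `c₂ = (j₂, i₂, k₂)` of the two perception pairs and an
isometric embedding `f` of `F` onto a dense subspace of `F'`, such that `i₂ ∘ A = f(A) ∘ i₁` for all
`A ∈ F` and `k₂ ∘ T = T' ∘ k₁`. -/
def IsCompactification (F : Set (GENEO P Q T)) (F' : Set (GENEO P' Q' T')) : Prop :=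
  IsCompact F' ∧
  ∃ (c₁ : P.Compactification P') (c₂ : Q.Compactification Q') (f : F → F'),
    Isometry f ∧ DenseRange f ∧
    (∀ A : F, c₂.i ∘ (A : GENEO P Q T).toFun = (f A : GENEO P' Q' T').toFun ∘ c₁.i) ∧
    c₂.k ∘ T = T' ∘ c₁.k

end GENEO

/-! Everything in sight is non-expansive, so it extends from a dense subspace to a completion, and
every identity or inequality between continuous maps is inherited from the dense part. What must be
shown is that the completions are compact and still form perception pairs.

By `totallyBounded_dom`, total boundedness of `Φ` forces that of `X` for `D_X`, so the completion
`Z` of `X` is compact. On `Z` take as signals the continuous functions restricting to the closure of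
`Φ`, and as group the isometric bijections that are uniform limits of elements of `G`. The signals
are compact as an isometric copy of that closure, `D_X` of the new pair is the metric of `Z`
(`edist_extPair_dom`), and the group is compact by Arzelà–Ascoli, with no assumption on `G`.

Collectionwise surjectivity makes `T` non-expansive, so `T` extends to `T'`, and then each operator
extends to one equivariant for `T'`. The operators between compact pairs form a compact space, again
by Arzelà–Ascoli, and `F'` is the closure of the extended family in it. -/

/-- A non-expansive map into a complete space extends along a dense isometric embedding. -/
theorem exists_lipschitz_extension {α β γ : Type*} [PseudoEMetricSpace α] [PseudoEMetricSpace β]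
    [PseudoEMetricSpace γ] [CompleteSpace γ] [T2Space γ] {e : α → β} (he : Isometry e)
    (hd : DenseRange e) {f : α → γ} (hf : LipschitzWith 1 f) :
    ∃ g : β → γ, LipschitzWith 1 g ∧ ∀ a, g (e a) = f a := by
  have hu := he.isUniformInducing
  have hg := uniformContinuous_uniformly_extend hu hd hf.uniformContinuous
  have heq : ∀ a, (hu.isDenseInducing hd).extend f (e a) = f a :=
    fun a => uniformly_extend_of_ind hu hd hf.uniformContinuous a
  refine ⟨_, fun x y => ?_, heq⟩
  simp only [ENNReal.coe_one, one_mul]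
  refine hd.induction_on₂ (p := fun x y => edist ((hu.isDenseInducing hd).extend f x)
    ((hu.isDenseInducing hd).extend f y) ≤ edist x y) ?_ (fun a b => ?_) x y
  · exact isClosed_le ((hg.continuous.comp continuous_fst).edist (hg.continuous.comp continuous_snd))
      (continuous_fst.edist continuous_snd)
  · rw [heq, heq, he.edist_eq]
    simpa using hf a b

theorem edist_iSup_comp_of_denseRange {α β γ : Type*} [TopologicalSpace β] [PseudoEMetricSpace γ]
    {e : α → β} (hd : DenseRange e) {f g : β → γ} (hf : Continuous f) (hg : Continuous g) :
    ⨆ b, edist (f b) (g b) = ⨆ a, edist (f (e a)) (g (e a)) := by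
  refine le_antisymm (iSup_le fun b => ?_) (iSup_le fun a => le_iSup (fun b => edist (f b) (g b)) _)
  refine hd.induction_on (p := fun b => edist (f b) (g b) ≤ _) b
    (isClosed_le (hf.edist hg) continuous_const) fun a => ?_
  exact le_iSup (fun a => edist (f (e a)) (g (e a))) a

/-! ### The uniform distance as a pointwise supremum. -/

namespace BddFun

variable {X : Type u}

theorem edist_eq_iSup (φ ψ : BddFun X) : edist φ ψ = ⨆ x, edist (φ x) (ψ x) := by
  refine le_antisymm ?_ (iSup_le fun x => ?_)
  · refine le_of_forall_ge fun c hc => ?_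
    induction c using ENNReal.recTopCoe with
    | top => exact le_top
    | coe c =>
      rw [edist_nndist, ENNReal.coe_le_coe, ← NNReal.coe_le_coe, coe_nndist, dist_eq_norm]
      refine lp.norm_le_of_forall_le c.2 fun x => ?_
      have := (le_iSup (fun x => edist (φ x) (ψ x)) x).trans hc
      rw [edist_nndist, ENNReal.coe_le_coe, ← NNReal.coe_le_coe, coe_nndist, dist_eq_norm] at this
      exact this
  · rw [edist_nndist, edist_nndist, ENNReal.coe_le_coe, ← NNReal.coe_le_coe, coe_nndist,
      coe_nndist, dist_eq_norm, dist_eq_norm]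
    exact lp.norm_apply_le_norm (by simp) (φ - ψ) x

theorem edist_apply_le (φ ψ : BddFun X) (x : X) : edist (φ x) (ψ x) ≤ edist φ ψ := by
  rw [edist_eq_iSup]
  exact le_iSup (fun x => edist (φ x) (ψ x)) x

theorem lipschitzWith_comp (g : X → X) : LipschitzWith 1 fun φ : BddFun X => φ.comp g := by
  intro φ ψ
  rw [ENNReal.coe_one, one_mul, edist_eq_iSup]
  exact iSup_le fun x => edist_apply_le φ ψ (g x)

theorem memℓp_pullback {Z : Type u'} (j : X → Z) (ψ : BddFun Z) :
    Memℓp (fun x => ψ (j x)) ∞ := by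
  rw [memℓp_infty_iff]
  refine (memℓp_infty_iff.1 (lp.memℓp ψ)).mono ?_
  rintro _ ⟨x, rfl⟩
  exact ⟨j x, rfl⟩

/-- The composite of a bounded function with a map between domains. -/
def pullback {Z : Type u'} (j : X → Z) (ψ : BddFun Z) : BddFun X :=
  ⟨fun x => ψ (j x), memℓp_pullback j ψ⟩

theorem edist_pullback {Z : Type u'} [TopologicalSpace Z] {j : X → Z} (hj : DenseRange j)
    {φ ψ : BddFun Z} (hφ : Continuous φ) (hψ : Continuous ψ) :
    edist (pullback j φ) (pullback j ψ) = edist φ ψ := by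
  rw [edist_eq_iSup, edist_eq_iSup, edist_iSup_comp_of_denseRange hj hφ hψ]
  rfl

end BddFun

/-! ### Distances and continuity of the action in a perception pair. -/

namespace PerceptionPair

variable {X : Type u} (P : PerceptionPair X)

theorem edist_dom (x y : P.Dom) : edist x y = ⨆ φ : P.Φ, edist (P.eval φ x) (P.eval φ y) := rfl

theorem edist_signals (φ ψ : P.Φ) : edist φ ψ = ⨆ x : P.Dom, edist (P.eval φ x) (P.eval ψ x) :=
  BddFun.edist_eq_iSup _ _

theorem eval_act (φ : P.Φ) (g : P.Grp) (x : P.Dom) :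
    P.eval (P.act φ g) x = P.eval φ (P.perm g x) := rfl

theorem perm_mul (g h : P.Grp) (x : P.Dom) : P.perm (g * h) x = P.perm g (P.perm h x) := rfl

theorem perm_injective : Function.Injective P.perm := Subtype.val_injective

theorem signals_ext {φ ψ : P.Φ} (h : ∀ x, P.eval φ x = P.eval ψ x) : φ = ψ :=
  Subtype.ext (lp.ext (funext h))

/-- Exchanging the suprema over signals and over points turns `D_Aut` into the uniform distance
between maps of `(X, D_X)`, which is how the group is handled from here on. -/
theorem edist_grp (g h : P.Grp) :
    edist g h = ⨆ x : P.Dom, edist (P.perm g x) (P.perm h x) := by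
  change ⨆ φ : P.Φ, edist (P.act φ g) (P.act φ h) = _
  simp only [edist_signals, edist_dom, eval_act]
  exact iSup_comm

theorem lipschitzWith_eval (φ : P.Φ) : LipschitzWith 1 (P.eval φ) := fun x y => by
  rw [ENNReal.coe_one, one_mul]
  exact le_iSup (fun φ : P.Φ => edist (P.eval φ x) (P.eval φ y)) φ

theorem edist_act_le (φ ψ : P.Φ) (g : P.Grp) : edist (P.act φ g) (P.act ψ g) ≤ edist φ ψ := by
  have h := BddFun.lipschitzWith_comp (P.perm g : X → X) (φ : BddFun X) (ψ : BddFun X)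
  rwa [ENNReal.coe_one, one_mul] at h

theorem edist_act_act_le (φ : P.Φ) (g h : P.Grp) : edist (P.act φ g) (P.act φ h) ≤ edist g h :=
  le_iSup (fun φ : P.Φ => edist (P.act φ g) (P.act φ h)) φ

theorem continuous_act : Continuous fun p : P.Φ × P.Grp => P.act p.1 p.2 := by
  refine LipschitzWith.continuous (K := 2) fun p q => ?_
  calc edist (P.act p.1 p.2) (P.act q.1 q.2)
      ≤ edist (P.act p.1 p.2) (P.act q.1 p.2) + edist (P.act q.1 p.2) (P.act q.1 q.2) :=
        edist_triangle _ _ _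
    _ ≤ edist p q + edist p q :=
        add_le_add ((P.edist_act_le _ _ _).trans (le_max_left _ _))
          ((P.edist_act_act_le _ _ _).trans (le_max_right _ _))
    _ = (2 : NNReal) * edist p q := by rw [ENNReal.coe_ofNat, two_mul]

/-- Composition with `g` maps `Φ` into itself, so the supremum for the image points runs over a
subfamily; apply this to `g` and to its inverse. -/
theorem isometry_perm (g : P.Grp) : Isometry (P.perm g) := by
  have key : ∀ (g : P.Grp) (x y : P.Dom), edist (P.perm g x) (P.perm g y) ≤ edist x y :=
    fun g x y => iSup_le fun φ =>
      le_iSup (fun φ : P.Φ => edist (P.eval φ x) (P.eval φ y)) (P.act φ g)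
  intro x y
  refine le_antisymm (key g x y) ?_
  have h := key g⁻¹ (P.perm g x) (P.perm g y)
  rwa [← perm_mul, ← perm_mul, inv_mul_cancel] at h

end PerceptionPair

/-! ### Extension of a perception pair along a dense isometric embedding. -/

namespace PerceptionPair

variable {X : Type u} (P : PerceptionPair X)

theorem edist_apply_le_of_mem_closure {φ : BddFun X} (hφ : φ ∈ closure P.Φ) (x y : P.Dom) :
    edist (φ x) (φ y) ≤ edist x y := by
  have hc : ∀ x : X, Continuous fun φ : BddFun X => φ x := fun x =>
    LipschitzWith.continuous (K := 1) fun φ ψ => by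
      simpa using BddFun.edist_apply_le φ ψ x
  refine closure_minimal (t := {φ : BddFun X | edist (φ x) (φ y) ≤ edist x y}) (fun ψ hψ => ?_)
    (isClosed_le ((hc x).edist (hc y)) continuous_const) hφ
  exact le_iSup (fun φ : P.Φ => edist (P.eval φ x) (P.eval φ y)) ⟨ψ, hψ⟩

variable {Z : Type u'} [MetricSpace Z] (j : P.Dom → Z)

/-- The continuous functions on `Z` that restrict to uniform limits of signals. -/
def extSignals : Set (BddFun Z) :=
  {ψ | Continuous ψ ∧ BddFun.pullback (X := X) j ψ ∈ closure P.Φ}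

/-- The bijective isometries of `Z` that are uniform limits of elements of the group. -/
def extGroup : Subgroup (Equiv.Perm Z) where
  carrier := {σ | Isometry σ ∧
    ∀ ε : ℝ≥0∞, 0 < ε → ∃ g : P.Grp, ∀ x, edist (σ (j x)) (j (P.perm g x)) ≤ ε}
  one_mem' := ⟨isometry_id, fun ε _ => ⟨1, fun x => by
    change edist (j x) (j x) ≤ ε
    simp⟩⟩
  mul_mem' := by
    rintro σ τ ⟨hσ, hσ'⟩ ⟨hτ, hτ'⟩
    refine ⟨hσ.comp hτ, fun ε hε => ?_⟩
    obtain ⟨g, hg⟩ := hσ' (ε / 2) (ENNReal.half_pos hε.ne')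
    obtain ⟨h, hh⟩ := hτ' (ε / 2) (ENNReal.half_pos hε.ne')
    refine ⟨g * h, fun x => ?_⟩
    calc edist (σ (τ (j x))) (j (P.perm g (P.perm h x)))
        ≤ edist (σ (τ (j x))) (σ (j (P.perm h x)))
          + edist (σ (j (P.perm h x))) (j (P.perm g (P.perm h x))) := edist_triangle _ _ _
      _ ≤ ε / 2 + ε / 2 := add_le_add (by rw [hσ.edist_eq]; exact hh x) (hg _)
      _ = ε := ENNReal.add_halves ε
  inv_mem' := by
    rintro σ ⟨hσ, hσ'⟩
    refine ⟨hσ.right_inv σ.apply_symm_apply, fun ε hε => ?_⟩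
    obtain ⟨g, hg⟩ := hσ' ε hε
    refine ⟨g⁻¹, fun x => ?_⟩
    have h := hg (P.perm g⁻¹ x)
    rw [← perm_mul, mul_inv_cancel] at h
    rw [← hσ.edist_eq, edist_comm]
    change edist (σ (j (P.perm g⁻¹ x))) (σ (σ.symm (j x))) ≤ ε
    rw [σ.apply_symm_apply]
    exact h

variable {P j}

theorem mem_extGroup {σ : Equiv.Perm Z} : σ ∈ P.extGroup j ↔ Isometry σ ∧
    ∀ ε : ℝ≥0∞, 0 < ε → ∃ g : P.Grp, ∀ x, edist (σ (j x)) (j (P.perm g x)) ≤ ε := Iff.rfl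

theorem lipschitzWith_of_mem_extSignals (hj : Isometry j) (hd : DenseRange j) {ψ : BddFun Z}
    (hψ : ψ ∈ P.extSignals j) : LipschitzWith 1 ψ := by
  intro z w
  rw [ENNReal.coe_one, one_mul]
  refine hd.induction_on₂ (p := fun z w => edist (ψ z) (ψ w) ≤ edist z w) ?_ (fun x y => ?_) z w
  · exact isClosed_le ((hψ.1.comp continuous_fst).edist (hψ.1.comp continuous_snd))
      (continuous_fst.edist continuous_snd)
  · rw [hj.edist_eq]
    exact P.edist_apply_le_of_mem_closure hψ.2 x y

/-- If `σ` is uniformly `δ`-close to `g` on the image of `j`, then, `ψ` being 1-Lipschitz, the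
restriction of `ψ ∘ σ` is `δ`-close to that of `ψ` composed with `g`, which stays in the closure of
`Φ`. -/
theorem comp_mem_extSignals (hj : Isometry j) (hd : DenseRange j) {ψ : BddFun Z}
    (hψ : ψ ∈ P.extSignals j) {σ : Equiv.Perm Z} (hσ : σ ∈ P.extGroup j) :
    ψ.comp σ ∈ P.extSignals j := by
  refine ⟨hψ.1.comp hσ.1.continuous, ?_⟩
  rw [← closure_closure, EMetric.mem_closure_iff]
  intro ε hε
  obtain ⟨δ, hδ, hδε⟩ := exists_between hε
  obtain ⟨g, hg⟩ := hσ.2 δ hδ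
  refine ⟨(BddFun.pullback (X := X) j ψ).comp (P.perm g), ?_, lt_of_le_of_lt ?_ hδε⟩
  · exact map_mem_closure (f := fun φ : BddFun X => φ.comp (P.perm g))
      (BddFun.lipschitzWith_comp (P.perm g : X → X)).continuous hψ.2
      fun φ hφ => (P.G_le g.2 φ hφ).1
  · rw [BddFun.edist_eq_iSup]
    refine iSup_le fun x => le_trans ?_ (hg x)
    have h := lipschitzWith_of_mem_extSignals hj hd hψ (σ (j x)) (j (P.perm g x))
    rwa [ENNReal.coe_one, one_mul] at h

variable (P) in
/-- The perception pair on `Z` formed by the uniform limits of signals and of group elements. -/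
def extPair (hj : Isometry j) (hd : DenseRange j) : PerceptionPair Z where
  Φ := P.extSignals j
  G := P.extGroup j
  G_le _ hσ _ hψ := ⟨comp_mem_extSignals hj hd hψ hσ,
    comp_mem_extSignals hj hd hψ ((P.extGroup j).inv_mem hσ)⟩

/-- Limits of signals are 1-Lipschitz for `D_X`, hence extend; compactness of `Z` keeps the
extension bounded. -/
theorem exists_mem_extSignals [CompactSpace Z] (hj : Isometry j) (hd : DenseRange j)
    {φ : BddFun X} (hφ : φ ∈ closure P.Φ) :
    ∃ ψ ∈ P.extSignals j, BddFun.pullback (X := X) j ψ = φ := by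
  obtain ⟨g, hg, hgj⟩ := exists_lipschitz_extension hj hd (f := fun x : P.Dom => φ x)
    (fun x y => by simpa using P.edist_apply_le_of_mem_closure hφ x y)
  have hb : Memℓp g ∞ :=
    memℓp_infty_iff.2 (isCompact_range (continuous_norm.comp hg.continuous)).bddAbove
  have he : BddFun.pullback (X := X) j ⟨g, hb⟩ = φ := lp.ext (funext hgj)
  exact ⟨⟨g, hb⟩, ⟨hg.continuous, he ▸ hφ⟩, he⟩

/-- The extensions of `g` and `g⁻¹` are mutually inverse because they are so on a dense set. -/
theorem exists_mem_extGroup [CompleteSpace Z] (hj : Isometry j) (hd : DenseRange j) (g : P.Grp) :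
    ∃ σ ∈ P.extGroup j, ∀ x, σ (j x) = j (P.perm g x) := by
  have key : ∀ g : P.Grp, ∃ f : Z → Z, LipschitzWith 1 f ∧ ∀ x, f (j x) = j (P.perm g x) :=
    fun g => exists_lipschitz_extension hj hd (hj.comp (P.isometry_perm g)).lipschitz
  have inv : ∀ (g : P.Grp) {f f' : Z → Z}, LipschitzWith 1 f → LipschitzWith 1 f' →
      (∀ x, f (j x) = j (P.perm g x)) → (∀ x, f' (j x) = j (P.perm g⁻¹ x)) →
      Function.LeftInverse f' f := by
    intro g f f' hf hf' h h'
    refine congr_fun (hd.equalizer (hf'.continuous.comp hf.continuous) continuous_id ?_)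
    funext x
    change f' (f (j x)) = j x
    rw [h, h', ← perm_mul, inv_mul_cancel]
    rfl
  obtain ⟨f, hf, h⟩ := key g
  obtain ⟨f', hf', h'⟩ := key g⁻¹
  have h₁ := inv g hf hf' h h'
  have h₂ := inv g⁻¹ hf' hf h' (by simpa using h)
  refine ⟨⟨f, f', h₁, h₂⟩, ⟨fun x y => le_antisymm (by simpa using hf x y) ?_, fun ε _ => ⟨g, ?_⟩⟩, h⟩
  · have := hf' (f x) (f y)
    rw [h₁, h₁] at this
    simpa using this
  · intro x
    change edist (f (j x)) _ ≤ ε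
    rw [h, edist_self]
    exact zero_le

section

variable (hj : Isometry j) (hd : DenseRange j)

/-- The extended signals are 1-Lipschitz, which gives one inequality. They include an extension of
each signal in `Φ`, which gives the other on the image of `j`, and density does the rest. -/
theorem edist_extPair_dom [CompactSpace Z] (z w : (P.extPair hj hd).Dom) :
    edist z w = @edist Z _ z w := by
  have hle : ∀ z w : (P.extPair hj hd).Dom, edist z w ≤ @edist Z _ z w := fun z w =>
    iSup_le fun ψ => by
      have h := lipschitzWith_of_mem_extSignals hj hd ψ.2 z w
      rwa [ENNReal.coe_one, one_mul] at h
  refine le_antisymm (hle z w) ?_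
  -- The topology of the new `D_X` is not yet known to be that of `Z`; `hle` makes the identity
  -- continuous in the direction needed for the density argument.
  let e : Z → (P.extPair hj hd).Dom := id
  have he : Continuous e := LipschitzWith.continuous (K := 1) fun z w => by
    rw [ENNReal.coe_one, one_mul]
    exact hle z w
  refine hd.induction_on₂ (p := fun z w => edist z w ≤ edist (e z) (e w)) ?_ (fun x y => ?_) z w
  · exact isClosed_le (continuous_fst.edist continuous_snd)
      ((he.comp continuous_fst).edist (he.comp continuous_snd))
  · rw [hj.edist_eq]
    refine iSup_le fun φ => ?_
    obtain ⟨ψ, hψ, hψφ⟩ := exists_mem_extSignals hj hd (subset_closure φ.2)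
    refine le_trans (le_of_eq ?_) (le_iSup (fun ψ : (P.extPair hj hd).Φ =>
      edist ((P.extPair hj hd).eval ψ (j x)) ((P.extPair hj hd).eval ψ (j y))) ⟨ψ, hψ⟩)
    change edist ((φ : BddFun X) x) ((φ : BddFun X) y) = _
    rw [← hψφ]
    rfl

/-- The identity of `Z`, as a map to the domain of the extended pair. -/
def toExtPair (z : Z) : (P.extPair hj hd).Dom := z

theorem isometry_toExtPair [CompactSpace Z] : Isometry (toExtPair (P := P) hj hd) :=
  fun z w => edist_extPair_dom hj hd z w

theorem surjective_toExtPair : Function.Surjective (toExtPair (P := P) hj hd) :=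
  Function.surjective_id

theorem inducesMetric_extPair [CompactSpace Z] : (P.extPair hj hd).InducesMetric := by
  intro z w
  rw [edist_extPair_dom]
  exact ⟨edist_ne_top _ _, edist_eq_zero.1⟩

theorem compactSpace_extPair_dom [CompactSpace Z] : CompactSpace (P.extPair hj hd).Dom := by
  have h := isCompact_range (isometry_toExtPair (P := P) hj hd).continuous
  rw [(surjective_toExtPair hj hd).range_eq] at h
  exact isCompact_univ_iff.1 h

/-- Restriction of the signals of the extended pair to the original domain. -/
def restrict (ψ : (P.extPair hj hd).Φ) : BddFun X := BddFun.pullback (X := X) j (ψ : BddFun Z)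

theorem isometry_restrict : Isometry (restrict (P := P) hj hd) := fun φ ψ =>
  BddFun.edist_pullback hd φ.2.1 ψ.2.1

theorem range_restrict [CompactSpace Z] : Set.range (restrict (P := P) hj hd) = closure P.Φ := by
  ext φ
  constructor
  · rintro ⟨ψ, rfl⟩
    exact ψ.2.2
  · intro hφ
    obtain ⟨ψ, hψ, h⟩ := exists_mem_extSignals hj hd hφ
    exact ⟨⟨ψ, hψ⟩, h⟩

theorem compactSpace_extPair_signals [CompactSpace Z] (hP : TotallyBounded P.Φ) :
    CompactSpace (P.extPair hj hd).Φ := by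
  rw [← isCompact_univ_iff, (isometry_restrict hj hd).isUniformInducing.isInducing.isCompact_iff,
    Set.image_univ, range_restrict]
  exact hP.closure.isCompact_of_isClosed isClosed_closure

theorem edist_extPair_grp [CompactSpace Z] (σ τ : (P.extPair hj hd).Grp) :
    edist σ τ = ⨆ z : Z, edist (σ.1 z) (τ.1 z) := by
  rw [edist_grp]
  exact iSup_congr fun z => edist_extPair_dom hj hd _ _

/-- The approximants preserve distances on the image of `j`, up to an error that tends to zero. With
`surjective_of_approx`, this shows that a uniform limit of group elements is automatically an
isometric bijection. -/
theorem isometry_of_approx {f : Z → Z} (hf : Continuous f) (hj : Isometry j) (hd : DenseRange j)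
    (h : ∀ ε : ℝ≥0∞, 0 < ε → ∃ g : P.Grp, ∀ x, edist (f (j x)) (j (P.perm g x)) ≤ ε) :
    Isometry f := by
  intro z w
  refine hd.induction_on₂ (p := fun z w => edist (f z) (f w) = edist z w) ?_ (fun x y => ?_) z w
  · exact isClosed_eq ((hf.comp continuous_fst).edist (hf.comp continuous_snd))
      (continuous_fst.edist continuous_snd)
  · have key : ∀ ε : ℝ≥0∞, 0 < ε → ∃ g : P.Grp, edist (f (j x)) (j (P.perm g x)) ≤ ε ∧
        edist (j (P.perm g y)) (f (j y)) ≤ ε := fun ε hε =>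
      (h ε hε).imp fun g hg => ⟨hg x, edist_comm (f (j y)) _ ▸ hg y⟩
    have hg : ∀ g : P.Grp, edist (j (P.perm g x)) (j (P.perm g y)) = edist (j x) (j y) := fun g => by
      rw [hj.edist_eq, hj.edist_eq, (P.isometry_perm g).edist_eq]
    refine le_antisymm ?_ ?_ <;> refine ENNReal.le_of_forall_pos_le_add fun ε hε _ => ?_ <;>
      obtain ⟨g, h₁, h₂⟩ := key (ε / 2) (ENNReal.half_pos (by simpa using hε.ne'))
    · calc edist (f (j x)) (f (j y)) ≤ edist (f (j x)) (j (P.perm g x))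
            + edist (j (P.perm g x)) (j (P.perm g y)) + edist (j (P.perm g y)) (f (j y)) :=
          edist_triangle4 _ _ _ _
        _ ≤ ε / 2 + edist (j x) (j y) + ε / 2 := by gcongr; exact (hg g).le
        _ = edist (j x) (j y) + ε := by rw [add_right_comm, ENNReal.add_halves, add_comm]
    · calc edist (j x) (j y) = edist (j (P.perm g x)) (j (P.perm g y)) := (hg g).symm
        _ ≤ edist (j (P.perm g x)) (f (j x)) + edist (f (j x)) (f (j y))
            + edist (f (j y)) (j (P.perm g y)) := edist_triangle4 _ _ _ _
        _ ≤ ε / 2 + edist (f (j x)) (f (j y)) + ε / 2 := by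
          gcongr
          · rwa [edist_comm]
          · rwa [edist_comm]
        _ = edist (f (j x)) (f (j y)) + ε := by rw [add_right_comm, ENNReal.add_halves, add_comm]

/-- The range is compact, hence closed, and it is dense because `f` takes the image of `g⁻¹ x` close
to that of `x`. -/
theorem surjective_of_approx [CompactSpace Z] {f : Z → Z} (hf : Continuous f) (hd : DenseRange j)
    (h : ∀ ε : ℝ≥0∞, 0 < ε → ∃ g : P.Grp, ∀ x, edist (f (j x)) (j (P.perm g x)) ≤ ε) :
    Function.Surjective f := by
  have hcl : IsClosed (Set.range f) := (isCompact_range hf).isClosed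
  rw [← Set.range_eq_univ, ← hcl.closure_eq, Set.eq_univ_iff_forall]
  refine fun z => closure_minimal ?_ isClosed_closure (hd z)
  rintro _ ⟨x, rfl⟩
  rw [EMetric.mem_closure_iff]
  intro ε hε
  obtain ⟨δ, hδ, hδε⟩ := exists_between hε
  obtain ⟨g, hg⟩ := h δ hδ
  refine ⟨f (j (P.perm g⁻¹ x)), ⟨_, rfl⟩, lt_of_le_of_lt ?_ hδε⟩
  have := hg (P.perm g⁻¹ x)
  rw [← perm_mul, mul_inv_cancel] at this
  rw [edist_comm]
  exact this

-- Inside the continuous self-maps of `Z`, the group is exactly the set of uniformly approximable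
-- maps, which is closed and consists of isometries, so Arzelà–Ascoli applies.
open BoundedContinuousFunction in
theorem compactSpace_extPair_grp [CompactSpace Z] : CompactSpace (P.extPair hj hd).Grp := by
  let ι : (P.extPair hj hd).Grp → (Z →ᵇ Z) := fun σ =>
    mkOfCompact ⟨σ.1, (mem_extGroup.1 σ.2).1.continuous⟩
  have hι : Isometry ι := fun σ τ => by
    rw [edist_extPair_grp, BoundedContinuousFunction.edist_eq_iSup]
    rfl
  let A : Set (Z →ᵇ Z) :=
    {f | ∀ ε : ℝ≥0∞, 0 < ε → ∃ g : P.Grp, ∀ x, edist (f (j x)) (j (P.perm g x)) ≤ ε}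
  have hA : Set.range ι = A := by
    ext f
    constructor
    · rintro ⟨σ, rfl⟩
      exact (mem_extGroup.1 σ.2).2
    · intro hf
      have hi := isometry_of_approx f.continuous hj hd hf
      let σ : Equiv.Perm Z :=
        Equiv.ofBijective f ⟨hi.injective, surjective_of_approx f.continuous hd hf⟩
      exact ⟨⟨σ, hi, hf⟩, rfl⟩
  have hcl : IsClosed A := by
    refine isClosed_of_closure_subset fun f hf ε hε => ?_
    obtain ⟨f', hf', hff'⟩ := EMetric.mem_closure_iff.1 hf (ε / 2) (ENNReal.half_pos hε.ne')
    obtain ⟨g, hg⟩ := hf' (ε / 2) (ENNReal.half_pos hε.ne')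
    refine ⟨g, fun x => ?_⟩
    calc edist (f (j x)) (j (P.perm g x))
        ≤ edist (f (j x)) (f' (j x)) + edist (f' (j x)) (j (P.perm g x)) := edist_triangle _ _ _
      _ ≤ ε / 2 + ε / 2 := by
        refine add_le_add (le_trans ?_ hff'.le) (hg x)
        rw [BoundedContinuousFunction.edist_eq_iSup]
        exact le_iSup (fun z => edist (f z) (f' z)) (j x)
      _ = ε := ENNReal.add_halves ε
  have heq : Equicontinuous ((↑) : A → Z → Z) :=
    (LipschitzWith.uniformEquicontinuous _ 1 fun f =>
      (isometry_of_approx f.1.continuous hj hd f.2).lipschitz).equicontinuous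
  rw [← isCompact_univ_iff, hι.isUniformInducing.isInducing.isCompact_iff, Set.image_univ, hA]
  exact arzela_ascoli₁ A hcl heq

theorem nonempty_compactification_extPair [CompactSpace Z] (hP : TotallyBounded P.Φ)
    (hX : P.InducesMetric) : Nonempty (P.Compactification (P.extPair hj hd)) := by
  choose i hi hij using fun φ : P.Φ => exists_mem_extSignals hj hd (subset_closure φ.2)
  choose k hk hkj using fun g : P.Grp => exists_mem_extGroup hj hd g
  let i' : P.Φ → (P.extPair hj hd).Φ := fun φ => ⟨i φ, hi φ⟩
  let k' : P.Grp → (P.extPair hj hd).Grp := fun g => ⟨k g, hk g⟩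
  have hri : ∀ φ, restrict hj hd (i' φ) = φ := hij
  have hinj : Function.Injective j := fun x y h => (hX x y).2 (by rw [← hj.edist_eq, h, edist_self])
  have hg : ∀ σ τ : (P.extPair hj hd).Grp, edist σ τ = ⨆ x, edist (σ.1 (j x)) (τ.1 (j x)) :=
    fun σ τ => by
      rw [edist_extPair_grp]
      exact edist_iSup_comp_of_denseRange hd (mem_extGroup.1 σ.2).1.continuous
        (mem_extGroup.1 τ.2).1.continuous
  exact ⟨{
    j := j
    i := i'
    k := k'
    isometry_j := fun x y => (edist_extPair_dom hj hd _ _).trans (hj x y)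
    isometry_i := fun φ ψ => by
      rw [← (isometry_restrict hj hd).edist_eq, hri, hri]
      rfl
    isometry_k := fun g h => by
      rw [hg, edist_grp]
      refine iSup_congr fun x => ?_
      change edist (k g (j x)) (k h (j x)) = _
      rw [hkj, hkj, hj.edist_eq]
    injective_j := hinj
    injective_k := fun g h hgh => by
      refine P.perm_injective (Equiv.ext fun x => hinj ?_)
      rw [← hkj, ← hkj, show k g = k h from congrArg Subtype.val hgh]
    dense_j := (surjective_toExtPair hj hd).denseRange.comp hd
      (isometry_toExtPair hj hd).continuous
    dense_i := fun ψ => by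
      rw [EMetric.mem_closure_iff]
      intro ε hε
      obtain ⟨φ, hφ, h⟩ := EMetric.mem_closure_iff.1 ψ.2.2 ε hε
      refine ⟨_, ⟨⟨φ, hφ⟩, rfl⟩, ?_⟩
      rw [← (isometry_restrict hj hd).edist_eq, hri]
      exact h
    dense_k := fun σ => by
      rw [EMetric.mem_closure_iff]
      intro ε hε
      obtain ⟨δ, hδ, hδε⟩ := exists_between hε
      obtain ⟨g, h⟩ := (mem_extGroup.1 σ.2).2 δ hδ
      refine ⟨_, ⟨g, rfl⟩, lt_of_le_of_lt ?_ hδε⟩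
      rw [hg]
      refine iSup_le fun x => ?_
      change edist (σ.1 (j x)) (k g (j x)) ≤ δ
      rw [hkj]
      exact h x
    eval_i := fun φ x => congrArg (fun f : BddFun X => f x) (hij φ)
    perm_k := hkj
    compact := ⟨compactSpace_extPair_signals hj hd hP, compactSpace_extPair_grp hj hd,
      compactSpace_extPair_dom hj hd⟩
    metric := inducesMetric_extPair hj hd }⟩

end

/-! ### Total boundedness of the domain and its compact completion. -/

/-- The domain of a perception pair with totally bounded set of signals is totally bounded. -/
theorem totallyBounded_dom (hP : TotallyBounded P.Φ) :
    TotallyBounded (Set.univ : Set P.Dom) := by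
  rw [EMetric.totallyBounded_iff]
  intro ε hε
  obtain ⟨δ, hδ, hδε⟩ : ∃ δ : ℝ≥0∞, 0 < δ ∧ δ + δ + δ < ε := by
    obtain ⟨ε', hε', h⟩ := exists_between hε
    refine ⟨ε' / 3, ENNReal.div_pos hε'.ne' (by simp), ?_⟩
    rwa [ENNReal.add_thirds]
  obtain ⟨t, htP, ht, hcov⟩ := EMetric.totallyBounded_iff'.1 hP δ hδ
  have : Fintype t := ht.fintype
  -- Evaluation on a finite `δ`-net `t` of signals lands in a bounded box of a finite-dimensional
  -- space. Points with `δ`-close values on `t` have values within `3δ` for every signal.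
  let E : P.Dom → t → ℝ := fun x φ => (φ : BddFun X) x
  have hE : TotallyBounded (E '' Set.univ) := by
    refine (isCompact_univ_pi fun φ : t =>
      isCompact_closedBall (0 : ℝ) ‖(φ : BddFun X)‖).totallyBounded.subset ?_
    rintro _ ⟨x, -, rfl⟩ φ -
    rw [mem_closedBall_zero_iff]
    exact lp.norm_apply_le_norm (by simp) (φ : BddFun X) x
  obtain ⟨s, -, hs, hsE⟩ := Set.exists_subset_image_finite_and.1
    (EMetric.totallyBounded_iff'.1 hE δ hδ)
  refine ⟨s, hs, fun x _ => ?_⟩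
  obtain ⟨_, ⟨y, hy, rfl⟩, hxy⟩ := Set.mem_iUnion₂.1 (hsE ⟨x, trivial, rfl⟩)
  refine Set.mem_iUnion₂.2 ⟨y, hy, lt_of_le_of_lt (iSup_le fun φ => ?_) hδε⟩
  obtain ⟨ψ, hψ, hφψ⟩ := Set.mem_iUnion₂.1 (hcov φ.2)
  calc edist ((φ : BddFun X) x) ((φ : BddFun X) y)
      ≤ edist ((φ : BddFun X) x) (ψ x) + edist (ψ x) (ψ y)
        + edist (ψ y) ((φ : BddFun X) y) := edist_triangle4 _ _ _ _
    _ ≤ δ + δ + δ := by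
      refine add_le_add (add_le_add ((BddFun.edist_apply_le _ _ _).trans hφψ.le) ?_) ?_
      · exact (edist_le_pi_edist (E x) (E y) ⟨ψ, hψ⟩).trans hxy.le
      · rw [edist_comm]
        exact (BddFun.edist_apply_le _ _ _).trans hφψ.le

theorem exists_compact_completion (hP : TotallyBounded P.Φ) (hX : P.InducesMetric) :
    ∃ (Z : Type u) (_ : MetricSpace Z) (j : P.Dom → Z),
      CompactSpace Z ∧ Isometry j ∧ DenseRange j := by
  let _ : PseudoMetricSpace P.Dom := PseudoEMetricSpace.toPseudoMetricSpace fun x y => (hX x y).1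
  refine ⟨UniformSpace.Completion P.Dom, inferInstance, (↑), ?_,
    UniformSpace.Completion.coe_isometry, UniformSpace.Completion.denseRange_coe⟩
  rw [← isCompact_univ_iff]
  have h := ((totallyBounded_dom hP).image
    (UniformSpace.Completion.uniformContinuous_coe P.Dom)).closure
  rw [Set.image_univ, UniformSpace.Completion.denseRange_coe.closure_range] at h
  exact h.isCompact_of_isClosed isClosed_univ

theorem exists_compactification (hP : TotallyBounded P.Φ) (hX : P.InducesMetric) :
    ∃ (X' : Type u) (P' : PerceptionPair X'), Nonempty (P.Compactification P') := by
  obtain ⟨Z, _, j, _, hj, hd⟩ := exists_compact_completion hP hX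
  exact ⟨Z, P.extPair hj hd, nonempty_compactification_extPair hj hd hP hX⟩

end PerceptionPair

/-! ### Compatibility of compactifications with the group structure and the action. -/

namespace PerceptionPair

variable {X : Type u} {X' : Type u'} {P : PerceptionPair X} {P' : PerceptionPair X'}

theorem InducesMetric.t2Space_dom (h : P.InducesMetric) : T2Space P.Dom :=
  have : T0Space P.Dom := ⟨fun x y hxy => (h x y).2 (EMetric.inseparable_iff.1 hxy)⟩
  inferInstance

theorem InducesMetric.t2Space_grp (h : P.InducesMetric) : T2Space P.Grp :=
  have : T0Space P.Grp := ⟨fun g g' hg => P.perm_injective <| Equiv.ext fun x => (h _ _).2 <| by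
    have hg := EMetric.inseparable_iff.1 hg
    rw [edist_grp] at hg
    exact ENNReal.iSup_eq_zero.1 hg x⟩
  inferInstance

/-- Left translations preserve `D_Aut` because group elements are isometries; right translations do
not increase it because they only reparametrize the points. -/
theorem continuous_mul_grp : Continuous fun p : P.Grp × P.Grp => p.1 * p.2 := by
  refine LipschitzWith.continuous (K := 2) fun p q => ?_
  calc edist (p.1 * p.2) (q.1 * q.2)
      ≤ edist (p.1 * p.2) (p.1 * q.2) + edist (p.1 * q.2) (q.1 * q.2) := edist_triangle _ _ _
    _ ≤ edist p q + edist p q := by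
      refine add_le_add (le_trans ?_ (le_max_right _ _)) (le_trans ?_ (le_max_left _ _))
      · rw [edist_grp, edist_grp]
        refine iSup_mono fun x => ?_
        rw [perm_mul, perm_mul, (P.isometry_perm p.1).edist_eq]
      · rw [edist_grp, edist_grp]
        exact iSup_le fun x => le_iSup (fun x => edist (P.perm p.1 x) (P.perm q.1 x)) _
    _ = (2 : NNReal) * edist p q := by rw [ENNReal.coe_ofNat, two_mul]

namespace Compactification

variable (c : P.Compactification P')

theorem i_act (φ : P.Φ) (g : P.Grp) : c.i (P.act φ g) = P'.act (c.i φ) (c.k g) := by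
  refine P'.signals_ext fun x => c.dense_j.induction_on
    (p := fun x => P'.eval (c.i (P.act φ g)) x = P'.eval (P'.act (c.i φ) (c.k g)) x) x
    (isClosed_eq (P'.lipschitzWith_eval _).continuous (P'.lipschitzWith_eval _).continuous) ?_
  intro x
  rw [c.eval_i, eval_act, eval_act, c.perm_k, c.eval_i]

theorem k_mul (g h : P.Grp) : c.k (g * h) = c.k g * c.k h := by
  have := c.metric.t2Space_dom
  refine P'.perm_injective (Equiv.ext fun x => c.dense_j.induction_on
    (p := fun x => P'.perm (c.k (g * h)) x = P'.perm (c.k g * c.k h) x) x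
    (isClosed_eq (P'.isometry_perm _).continuous (P'.isometry_perm _).continuous) ?_)
  intro x
  rw [c.perm_k, perm_mul, perm_mul, c.perm_k, c.perm_k]

end Compactification

end PerceptionPair

/-! ### Extension and compactness of spaces of operators. -/

namespace GENEO

variable {X : Type u} {Y : Type v} {P : PerceptionPair X} {Q : PerceptionPair Y}
  {T : P.Grp →* Q.Grp} {X' : Type u'} {Y' : Type v'} {P' : PerceptionPair X'}
  {Q' : PerceptionPair Y'} {T' : P'.Grp →* Q'.Grp}

theorem lipschitzWith (A : GENEO P Q T) : LipschitzWith 1 A.toFun :=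
  LipschitzWith.of_dist_le_mul fun φ ψ => by simpa using A.nonexpansive φ ψ

/-- A homomorphism with a collectionwise surjective family of operators is non-expansive. -/
theorem CollectionwiseSurjective.lipschitzWith {F : Set (GENEO P Q T)}
    (hF : CollectionwiseSurjective F) : LipschitzWith 1 T := by
  intro g h
  rw [ENNReal.coe_one, one_mul]
  refine iSup_le fun ψ => ?_
  -- Writing `ψ` as `A φ` turns its translates by `T g` and `T h` into the images under `A` of `φ ∘
  -- g` and `φ ∘ h`.
  obtain ⟨A, -, φ, rfl⟩ := hF ψ
  rw [← A.equivariant, ← A.equivariant]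
  have := A.lipschitzWith (P.act φ g) (P.act φ h)
  rw [ENNReal.coe_one, one_mul] at this
  exact this.trans (P.edist_act_act_le φ g h)

theorem exists_hom_extension (c₁ : P.Compactification P') (c₂ : Q.Compactification Q')
    (hT : LipschitzWith 1 T) :
    ∃ T' : P'.Grp →* Q'.Grp, LipschitzWith 1 T' ∧ ∀ g, T' (c₁.k g) = c₂.k (T g) := by
  have := c₂.metric.t2Space_grp
  have := c₂.compact.compact_group
  obtain ⟨T', hT', h⟩ := exists_lipschitz_extension c₁.isometry_k c₁.dense_k
    (f := c₂.k ∘ T) (by simpa using c₂.isometry_k.lipschitz.comp hT)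
  have hmul : ∀ g h, T' (g * h) = T' g * T' h := fun g g' => by
    refine c₁.dense_k.induction_on₂ (p := fun g g' => T' (g * g') = T' g * T' g')
      (isClosed_eq (hT'.continuous.comp PerceptionPair.continuous_mul_grp)
        (PerceptionPair.continuous_mul_grp.comp
          ((hT'.continuous.comp continuous_fst).prodMk (hT'.continuous.comp continuous_snd))))
      (fun a b => ?_) g g'
    rw [← c₁.k_mul, h, h, h, Function.comp_apply, map_mul, c₂.k_mul]
    rfl
  exact ⟨MonoidHom.mk' T' hmul, hT', h⟩

/-- Equivariance is a closed condition in the signal and in the group element separately, so it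
passes to the limit in one and then in the other. -/
theorem exists_extension (c₁ : P.Compactification P') (c₂ : Q.Compactification Q')
    (hT' : LipschitzWith 1 T') (h : ∀ g, T' (c₁.k g) = c₂.k (T g)) (A : GENEO P Q T) :
    ∃ A' : GENEO P' Q' T', ∀ φ, A'.toFun (c₁.i φ) = c₂.i (A.toFun φ) := by
  have := c₂.compact.compact_signals
  obtain ⟨f, hf, hfi⟩ := exists_lipschitz_extension c₁.isometry_i c₁.dense_i
    (f := c₂.i ∘ A.toFun) (by simpa using c₂.isometry_i.lipschitz.comp A.lipschitzWith)
  refine ⟨⟨f, fun φ g => ?_, fun φ ψ => by simpa using hf.dist_le_mul φ ψ⟩, hfi⟩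
  refine c₁.dense_i.induction_on (p := fun φ => f (P'.act φ g) = Q'.act (f φ) (T' g)) φ
    (isClosed_eq
      (hf.continuous.comp (P'.continuous_act.comp (continuous_id.prodMk continuous_const)))
      (Q'.continuous_act.comp (hf.continuous.prodMk continuous_const))) fun φ => ?_
  refine c₁.dense_k.induction_on
    (p := fun g => f (P'.act (c₁.i φ) g) = Q'.act (f (c₁.i φ)) (T' g)) g
    (isClosed_eq
      (hf.continuous.comp (P'.continuous_act.comp (continuous_const.prodMk continuous_id)))
      (Q'.continuous_act.comp (continuous_const.prodMk hT'.continuous))) fun g => ?_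
  rw [← c₁.i_act, hfi, hfi, Function.comp_apply, A.equivariant, c₂.i_act, h]
  rfl

open BoundedContinuousFunction in
/-- The space of operators between perception pairs with compact sets of signals is compact. -/
theorem compactSpace [CompactSpace P.Φ] [CompactSpace Q.Φ] : CompactSpace (GENEO P Q T) := by
  let ι : GENEO P Q T → (P.Φ →ᵇ Q.Φ) := fun A => mkOfCompact ⟨A.toFun, A.lipschitzWith.continuous⟩
  have hι : Isometry ι := fun A B => BoundedContinuousFunction.edist_eq_iSup
  have hr : Set.range ι = {f | (∀ φ g, f (P.act φ g) = Q.act (f φ) (T g)) ∧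
      ∀ φ ψ, dist (f φ) (f ψ) ≤ dist φ ψ} := by
    ext f
    constructor
    · rintro ⟨A, rfl⟩
      exact ⟨A.equivariant, A.nonexpansive⟩
    · rintro ⟨h₁, h₂⟩
      exact ⟨⟨f, h₁, h₂⟩, rfl⟩
  have hcl : IsClosed (Set.range ι) := by
    rw [hr]
    simp only [Set.ofPred_and, Set.ofPred_forall]
    refine (isClosed_iInter fun φ => isClosed_iInter fun g => ?_).inter
      (isClosed_iInter fun φ => isClosed_iInter fun ψ => ?_)
    · exact isClosed_eq (continuous_eval_const _)
        (Q.continuous_act.comp ((continuous_eval_const _).prodMk continuous_const))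
    · exact isClosed_le ((continuous_eval_const _).dist (continuous_eval_const _)) continuous_const
  have heq : Equicontinuous ((↑) : Set.range ι → P.Φ → Q.Φ) := by
    refine (LipschitzWith.uniformEquicontinuous _ 1 ?_).equicontinuous
    rintro ⟨_, A, rfl⟩
    exact A.lipschitzWith
  rw [← isCompact_univ_iff, hι.isUniformInducing.isInducing.isCompact_iff, Set.image_univ]
  exact arzela_ascoli₁ _ hcl heq

end GENEO

/-! ### The compactification of the family of operators. -/

theorem mainTheorem1 {X : Type u} {Y : Type v} [Nonempty X] [Nonempty Y]
    (P : PerceptionPair X) (Q : PerceptionPair Y) (T : P.Grp →* Q.Grp)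
    (F : Set (GENEO P Q T)) (hF : GENEO.CollectionwiseSurjective F)
    (hP : TotallyBounded P.Φ) (hQ : TotallyBounded Q.Φ)
    (hX : P.InducesMetric) (hY : Q.InducesMetric) :
    ∃ (X' : Type u) (Y' : Type v) (P' : PerceptionPair X') (Q' : PerceptionPair Y')
      (T' : P'.Grp →* Q'.Grp) (F' : Set (GENEO P' Q' T')),
      GENEO.IsCompactification F F' := by
  obtain ⟨X', P', ⟨c₁⟩⟩ := PerceptionPair.exists_compactification hP hX
  obtain ⟨Y', Q', ⟨c₂⟩⟩ := PerceptionPair.exists_compactification hQ hY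
  obtain ⟨T', hT', hT⟩ := GENEO.exists_hom_extension c₁ c₂ hF.lipschitzWith
  choose f hf using GENEO.exists_extension c₁ c₂ hT' hT
  have := c₁.compact.compact_signals
  have := c₂.compact.compact_signals
  have := GENEO.compactSpace (P := P') (Q := Q') (T := T')
  have hiso : Isometry f := fun A B => by
    change ⨆ φ : P'.Φ, edist ((f A).toFun φ) ((f B).toFun φ) = _
    rw [edist_iSup_comp_of_denseRange c₁.dense_i (f A).lipschitzWith.continuous
      (f B).lipschitzWith.continuous]
    refine iSup_congr fun φ => ?_
    rw [hf, hf, c₂.isometry_i.edist_eq]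
  -- The whole space of operators for `T'` is compact, so taking the closure gives compactness and
  -- density at once.
  refine ⟨X', Y', P', Q', T', closure (f '' F), isClosed_closure.isCompact, c₁, c₂,
    fun A => ⟨f A, subset_closure ⟨A, A.2, rfl⟩⟩, fun A B => hiso A B, ?_, fun A => ?_, ?_⟩
  · rintro ⟨B, hB⟩
    rw [EMetric.mem_closure_iff]
    intro ε hε
    obtain ⟨_, ⟨A, hA, rfl⟩, h⟩ := EMetric.mem_closure_iff.1 hB ε hε
    exact ⟨_, ⟨⟨A, hA⟩, rfl⟩, h⟩
  · exact funext fun φ => (hf A φ).symm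
  · exact funext fun g => (hT g).symm
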